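/- \textbf{Model.} A market is given by the quality space $\mathcal Q=\{L,H\}=\{0,1\}$ with uniform prior $\pi_0$, a reward function $r(q,\theta)$, a feedback function $f(q,\theta,\varepsilon)$ with values in a finite set $\mathcal Z$, and the laws of a preference $\theta$ and of an independent noise $\varepsilon$, with $\mathbb E|r(q,\theta)|<\infty$ for $q\in\mathcal Q$. For $\eta\in(0,\frac12)$ let $Q_0=X_0$ and, independently at each step, $Q_{t+1}=X_{t+1}$ with probability $\eta$ and $Q_{t+1}=Q_t$ with probability $1-\eta$, where the $X_t$ are i.i.d. with law $\pi_0$. Let $(\theta_t)_t$ and $(\varepsilon_t)_t$ be i.i.d. copies of $\theta$ and $\varepsilon$; these sequences, the $X_t$ and the redraw coins are all independent. At each time $t\ge1$, consumer $t$ observes the history $\mathcal H_t=(Z_s)_{1\le s<t}$ and $\theta_t$, and buys if and only if $\mathbb E[r(Q_t,\theta_t)\mid\mathcal H_t,\theta_t]>0$. Then $Z_t=f(Q_t,\theta_t,\varepsilon_t)$ in case of purchase, and $Z_t=*\notin\mathcal Z$ otherwise. For a belief $\pi$ on $\mathcal Q$, $q\in\mathcal Q$ and $z\in\mathcal Z$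 put $$G(z,\pi,q)=\mathbb P_{\theta,\varepsilon}\big[\mathbb E_{q'\sim\pi}[r(q',\theta)]>0 \text{ and } f(q,\theta,\varepsilon)=z\big].$$ \textbf{Assumptions.} (i) $r(L,\theta)\le r(H,\theta)$ for all $\theta$, and $\mathbb P(r(L,\theta)>0)>0$. (ii) For every belief $\pi$, $G(z,\pi,q)>0$ for all $z\in\mathcal Z$ and $q\in\mathcal Q$, and $G(z,\pi,L)\ne G(z,\pi,H)$ for some $z\in\mathcal Z$. (iii) $\delta(L,H):=\inf_{\pi}\sum_{z\in\mathcal Z}|G(z,\pi,L)-G(z,\pi,H)|>0$. \textbf{Theorem.} Let $\mathcal L_T=\sum_{t=1}^T\mathbb E\big[\,\big|\mathbb E[Q_t\mid\mathcal H_t]-Q_t\big|\,\big]$. If $\eta T=\Omega(1)$, then $\mathcal L_T=\Theta(\ln(1/\eta)\,\eta\,T)$. That is, for every such market and every $c_0>0$ there are constants $c,C>0$, depending only on the market and on $c_0$, such that for all $\eta\in(0,\frac12)$ and all integers $T\ge1$ with $\eta T\ge c_0$, $$c\,\ln(1/\eta)\,\eta\,T\;\le\;\mathcal L_T\;\le\;C\,\ln(1/\eta)\,\eta\,T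 .$$ -/

import Mathlib

open MeasureTheory ProbabilityTheory

noncomputable section

namespace SocialLearning

/-- The binary quality space `{L, H} = {0, 1}`: `false` is `L` and `true` is `H`. -/
abbrev Quality := Bool

/-- The low quality `L`. -/
abbrev L : Quality := false

/-- The high quality `H`. -/
abbrev H : Quality := true

/-- The numerical value of a quality, `L = 0` and `H = 1`. -/
def value (q : Quality) : ℝ := if q then 1 else 0

/-- The law on `Bool` giving mass `p` to `true` and mass `1 - p` to `false`. -/
def coinLaw (p : ℝ) : Measure Bool :=
  ENNReal.ofReal p • Measure.dirac true + ENNReal.ofReal (1 - p) • Measure.dirac false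

/-- The uniform prior on `{L, H}`. -/
def prior : Measure Quality := coinLaw (1 / 2)

/-- The primitives of the market: the reward function `r`, the feedback function `f`, the law of
the preferences `θ_t` (in `Θ`) and the law of the noises `ε_t` (in `E`). The feedback space `F`
is finite in the sequel. -/
structure Market (Θ E F : Type*) [MeasurableSpace Θ] [MeasurableSpace E] where
  reward : Quality → Θ → ℝ
  feedback : Quality → Θ → E → F
  prefLaw : Measure Θ
  noiseLaw : Measure E
  prefLaw_prob : IsProbabilityMeasure prefLaw
  noiseLaw_prob : IsProbabilityMeasure noiseLaw
  reward_measurable : ∀ q, Measurable (reward q)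
  /-- The conditional expected utilities of the consumers are well defined. -/
  reward_integrable : ∀ q, Integrable (reward q) prefLaw
  feedback_measurable : ∀ q z, MeasurableSet {x : Θ × E | feedback q x.1 x.2 = z}

namespace Market

variable {Θ E F : Type*} [MeasurableSpace Θ] [MeasurableSpace E]

/-- Expected reward of a consumer with preference `θ` when `Q` is distributed according to the
belief `π` on `{L, H}` with `π(H) = p`. -/
def expectedReward (M : Market Θ E F) (p : ℝ) (θ : Θ) : ℝ :=
  (1 - p) * M.reward L θ + p * M.reward H θ

/-- `G(z, π, q)`, with `p = π(H)`: the probability that the consumer buys under the belief `π`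
and gives the feedback `z`, when the quality is `q`. -/
def G (M : Market Θ E F) (z : F) (p : ℝ) (q : Quality) : ℝ :=
  (M.prefLaw.prod M.noiseLaw).real
    {x : Θ × E | 0 < M.expectedReward p x.1 ∧ M.feedback q x.1 x.2 = z}

/-- Purchase guarantee: the reward is non-decreasing in the quality, and with positive probability
a consumer is ready to buy even the lowest quality. -/
def PurchaseGuarantee (M : Market Θ E F) : Prop :=
  (∀ θ, M.reward L θ ≤ M.reward H θ) ∧ 0 < M.prefLaw {θ | 0 < M.reward L θ}

/-- Identifiability: for every belief, all feedbacks have positive probability, and the two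
qualities induce different feedback probabilities. -/
def Identifiable (M : Market Θ E F) : Prop :=
  ∀ p ∈ Set.Icc (0 : ℝ) 1,
    (∀ z q, 0 < M.G z p q) ∧ ∃ z, M.G z p L ≠ M.G z p H

/-- `δ(L, H)`: the infimum, over all beliefs `π`, of `∑_z |G(z, π, L) - G(z, π, H)|`. -/
def delta [Fintype F] (M : Market Θ E F) : ℝ :=
  ⨅ p : Set.Icc (0 : ℝ) 1, ∑ z : F, |M.G z p L - M.G z p H|

end Market

/-- The random inputs of the dynamic model with redraw probability `η`, on a probability space
`(Ω, μ)`: at each time `t` a potential new quality `X t` with uniform law, a coin `S t` equal to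
`true` with probability `η`, a preference `θ t` and a noise `ε t`, all independent of each other
and independent across times. -/
structure Inputs {Θ E F : Type*} [MeasurableSpace Θ] [MeasurableSpace E]
    (M : Market Θ E F) (η : ℝ) {Ω : Type*} [MeasurableSpace Ω] (μ : Measure Ω) where
  X : ℕ → Ω → Quality
  S : ℕ → Ω → Bool
  θ : ℕ → Ω → Θ
  ε : ℕ → Ω → E
  X_measurable : ∀ t, Measurable (X t)
  S_measurable : ∀ t, Measurable (S t)
  θ_measurable : ∀ t, Measurable (θ t)
  ε_measurable : ∀ t, Measurable (ε t)
  law : ∀ t, μ.map (fun ω => (X t ω, S t ω, θ t ω, ε t ω)) =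
    prior.prod ((coinLaw η).prod (M.prefLaw.prod M.noiseLaw))
  indep : iIndepFun (fun t ω => (X t ω, S t ω, θ t ω, ε t ω)) μ

namespace Inputs

variable {Θ E F : Type*} [MeasurableSpace Θ] [MeasurableSpace E] {M : Market Θ E F} {η : ℝ}
  {Ω : Type*} [MeasurableSpace Ω] {μ : Measure Ω}

/-- The quality process: `Q_0 = X_0`, and `Q_{t+1}` is `X_{t+1}` if the coin of time `t + 1` says
so (probability `η`), and `Q_t` otherwise. -/
def Q (I : Inputs M η μ) : ℕ → Ω → Quality
  | 0 => I.X 0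
  | t + 1 => fun ω => if I.S (t + 1) ω then I.X (t + 1) ω else I.Q t ω

open Classical in
/-- The review `Z_t` for `t ≥ 1` (`none` stands for no purchase). Consumer `t` buys if and only if
the conditional expectation of `r(Q_t, θ_t)` given `Z_1, …, Z_{t-1}` and `θ_t` is positive, in
which case the review is `f(Q_t, θ_t, ε_t)`. -/
def review (I : Inputs M η μ) (t : ℕ) : Ω → Option F := fun ω =>
  if 0 < (μ[fun ω' => M.reward (I.Q t ω') (I.θ t ω') |
      (⨆ s : {s : ℕ // 1 ≤ s ∧ s < t}, MeasurableSpace.comap (I.review s.1) ⊤) ⊔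
        MeasurableSpace.comap (I.θ t) inferInstance]) ω
  then some (M.feedback (I.Q t ω) (I.θ t ω) (I.ε t ω))
  else none
termination_by t
decreasing_by exact s.2.2

/-- The information of the history `ℋ_t = (Z_s)_{1 ≤ s < t}`. -/
@[reducible] def history (I : Inputs M η μ) (t : ℕ) : MeasurableSpace Ω :=
  ⨆ s : {s : ℕ // 1 ≤ s ∧ s < t}, MeasurableSpace.comap (I.review s.1) ⊤

open Classical in
theorem review_eq (I : Inputs M η μ) (t : ℕ) (ω : Ω) :
    I.review t ω =
      if 0 < (μ[fun ω' => M.reward (I.Q t ω') (I.θ t ω') |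
          I.history t ⊔ MeasurableSpace.comap (I.θ t) inferInstance]) ω
      then some (M.feedback (I.Q t ω) (I.θ t ω) (I.ε t ω))
      else none := by
  rw [review]

/-- The cumulative loss `ℒ_T = ∑_{t=1}^T E[|E[Q_t | ℋ_t] - Q_t|]`. -/
def loss (I : Inputs M η μ) (T : ℕ) : ℝ :=
  ∑ t ∈ Finset.Icc 1 T,
    ∫ ω, ‖(μ[fun ω' => value (I.Q t ω') | I.history t]) ω - value (I.Q t ω)‖ ∂μ

end Inputs

end SocialLearning

end

/-!
The potential is the mean entropy of the belief of consumer `t` about `Q_t`, which stays in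
`[0, log 2]`. A redraw of the quality with probability `η` raises it by at most a constant times
`η * log (1 / η)`. It raises it by at least a constant times this quantity unless the belief is
already uncertain, and then the error of the belief makes up for the difference. A review lowers the
entropy by the mutual information between `Q_t` and `Z_t`, a sum of Jensen gaps of `-x * log x`.
The decrease is at least proportional to the expected error of the belief, that is, to the loss of
time `t`, because `-x * log x` is strongly concave on `[0, 1]` and the qualities are uniformly
separated by their feedback. It is at most proportional to the loss because the feedback
probabilities stay away from `0`, where the second derivative blows up. Summing over time,
`T * η * log (1 / η)` and the total loss agree up to constants and a boundary term `log 2`, which is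
absorbed when `η * T` is bounded below.
-/

noncomputable section

namespace SocialLearning

section Entropy

open Real

/-- The entropy of a pair of masses: the Shannon entropy of `(x, y)` when `x + y = 1`, extended
to be homogeneous of degree one. -/
def massEntropy (x y : ℝ) : ℝ := negMulLog x + negMulLog y - negMulLog (x + y)

theorem massEntropy_mul (c x y : ℝ) : massEntropy (c * x) (c * y) = c * massEntropy x y := by
  simp only [massEntropy, ← mul_add, negMulLog_mul]
  ring

theorem massEntropy_one_sub (p : ℝ) : massEntropy p (1 - p) = binEntropy p := by
  simp [massEntropy, binEntropy_eq_negMulLog_add_negMulLog_one_sub]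

theorem massEntropy_nonneg {x y : ℝ} (hx : 0 ≤ x) (hy : 0 ≤ y) : 0 ≤ massEntropy x y := by
  rcases (add_nonneg hx hy).eq_or_lt with h | h
  · obtain ⟨rfl, rfl⟩ := (add_eq_zero_iff_of_nonneg hx hy).1 h.symm
    simp [massEntropy]
  · have hscale := massEntropy_mul (x + y) (x / (x + y)) (1 - x / (x + y))
    rw [massEntropy_one_sub, mul_one_sub, mul_div_cancel₀ _ h.ne', add_sub_cancel_left] at hscale
    rw [hscale]
    exact mul_nonneg h.le (binEntropy_nonneg (by positivity) (by rw [div_le_one h]; linarith))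

theorem negMulLog_add_le {x y : ℝ} (hx : 0 ≤ x) (hy : 0 ≤ y) :
    negMulLog (x + y) ≤ negMulLog x + negMulLog y :=
  sub_nonneg.1 (massEntropy_nonneg hx hy)

/-- The Jensen gap of `negMulLog` for the weights `p` and `1 - p`: the contribution of an outcome
of likelihoods `a` and `b` to the mutual information between the outcome and a hidden bit of
prior `p`. -/
def jensenGap (p a b : ℝ) : ℝ :=
  negMulLog (p * a + (1 - p) * b) - (p * negMulLog a + (1 - p) * negMulLog b)

theorem jensenGap_self (p a : ℝ) : jensenGap p a a = 0 := by
  simp only [jensenGap, ← add_mul, add_sub_cancel, one_mul, sub_self]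

theorem massEntropy_mul_mul (p a b : ℝ) :
    massEntropy (p * a) ((1 - p) * b) =
      a * negMulLog p + b * negMulLog (1 - p) - jensenGap p a b := by
  simp only [massEntropy, jensenGap, negMulLog_mul]
  ring

theorem hasDerivAt_negMulLog_add_mul_sq (c : ℝ) {x : ℝ} (hx : x ≠ 0) :
    HasDerivAt (fun x => negMulLog x + c * x ^ 2) (-log x - 1 + 2 * c * x) x := by
  refine ((hasDerivAt_negMulLog hx).add ((hasDerivAt_pow 2 x).const_mul c)).congr_deriv ?_
  norm_num
  ring

theorem hasDerivAt_neg_log_sub_one_add (c : ℝ) {x : ℝ} (hx : x ≠ 0) :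
    HasDerivAt (fun x => -log x - 1 + 2 * c * x) (-x⁻¹ + 2 * c) x :=
  (((hasDerivAt_log hx).neg.sub_const 1).add ((hasDerivAt_id x).const_mul (2 * c))).congr_deriv
    (by rw [mul_one])

theorem concaveOn_negMulLog_add_sq_div_two :
    ConcaveOn ℝ (Set.Icc 0 1) fun x => negMulLog x + 1 / 2 * x ^ 2 := by
  refine concaveOn_of_hasDerivWithinAt2_nonpos (convex_Icc 0 1) (by fun_prop)
    (fun x hx => (hasDerivAt_negMulLog_add_mul_sq _ ?_).hasDerivWithinAt)
    (fun x hx => (hasDerivAt_neg_log_sub_one_add _ ?_).hasDerivWithinAt) fun x hx => ?_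
  all_goals rw [interior_Icc] at hx
  · exact hx.1.ne'
  · exact hx.1.ne'
  · linarith [(one_le_inv₀ hx.1).2 hx.2.le]

theorem convexOn_negMulLog_add_sq_div {γ : ℝ} (hγ : 0 < γ) :
    ConvexOn ℝ (Set.Ici γ) fun x => negMulLog x + 1 / (2 * γ) * x ^ 2 := by
  refine convexOn_of_hasDerivWithinAt2_nonneg (convex_Ici γ) (by fun_prop)
    (fun x hx => (hasDerivAt_negMulLog_add_mul_sq _ ?_).hasDerivWithinAt)
    (fun x hx => (hasDerivAt_neg_log_sub_one_add _ ?_).hasDerivWithinAt) fun x hx => ?_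
  all_goals rw [interior_Ici, Set.mem_Ioi] at hx
  · exact (hγ.trans hx).ne'
  · exact (hγ.trans hx).ne'
  · have : x⁻¹ ≤ γ⁻¹ := inv_anti₀ hγ hx.le
    have : 2 * (1 / (2 * γ)) = γ⁻¹ := by field_simp
    linarith

theorem le_jensenGap {p a b : ℝ} (hp : p ∈ Set.Icc (0 : ℝ) 1) (ha : a ∈ Set.Icc (0 : ℝ) 1)
    (hb : b ∈ Set.Icc (0 : ℝ) 1) : p * (1 - p) / 2 * (a - b) ^ 2 ≤ jensenGap p a b := by
  have h := concaveOn_negMulLog_add_sq_div_two.2 ha hb hp.1 (sub_nonneg.2 hp.2)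
    (add_sub_cancel p 1)
  simp only [smul_eq_mul] at h
  unfold jensenGap
  linarith

theorem jensenGap_le {p a b γ : ℝ} (hp : p ∈ Set.Icc (0 : ℝ) 1) (hγ : 0 < γ) (ha : γ ≤ a)
    (hb : γ ≤ b) : jensenGap p a b ≤ p * (1 - p) / (2 * γ) * (a - b) ^ 2 := by
  have h := (convexOn_negMulLog_add_sq_div hγ).2 (Set.mem_Ici.2 ha) (Set.mem_Ici.2 hb) hp.1
    (sub_nonneg.2 hp.2) (add_sub_cancel p 1)
  simp only [smul_eq_mul] at h
  rw [div_eq_mul_one_div]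
  unfold jensenGap
  linarith

/-- The expected entropy of a hidden bit of prior `p` after the observation of an outcome `i` that
has probability `g i` if the bit is `true` and `k i` if it is `false`. -/
def posteriorEntropy {ι : Type*} [Fintype ι] (p : ℝ) (g k : ι → ℝ) : ℝ :=
  ∑ i, massEntropy (p * g i) ((1 - p) * k i)

section Channel

variable {ι : Type*} [Fintype ι] {p γ : ℝ} {g k : ι → ℝ}

theorem posteriorEntropy_eq (p : ℝ) (hg : ∑ i, g i = 1) (hk : ∑ i, k i = 1) :
    posteriorEntropy p g k = binEntropy p - ∑ i, jensenGap p (g i) (k i) := by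
  simp only [posteriorEntropy, massEntropy_mul_mul, Finset.sum_sub_distrib,
    Finset.sum_add_distrib, ← Finset.sum_mul, hg, hk, one_mul,
    binEntropy_eq_negMulLog_add_negMulLog_one_sub]

theorem posteriorEntropy_le (hp : p ∈ Set.Icc (0 : ℝ) 1) (hg0 : 0 ≤ g) (hk0 : 0 ≤ k)
    (hg : ∑ i, g i = 1) (hk : ∑ i, k i = 1) :
    posteriorEntropy p g k ≤ binEntropy p - p * (1 - p) / 2 * ∑ i, (g i - k i) ^ 2 := by
  have le_one {f : ι → ℝ} (hf0 : 0 ≤ f) (hf : ∑ i, f i = 1) (i : ι) : f i ≤ 1 :=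
    hf ▸ Finset.single_le_sum (fun j _ => hf0 j) (Finset.mem_univ i)
  rw [posteriorEntropy_eq p hg hk, Finset.mul_sum]
  exact sub_le_sub_left (Finset.sum_le_sum fun i _ =>
    le_jensenGap hp ⟨hg0 i, le_one hg0 hg i⟩ ⟨hk0 i, le_one hk0 hk i⟩) _

theorem le_posteriorEntropy (hp : p ∈ Set.Icc (0 : ℝ) 1) (hγ : 0 < γ)
    (hgk : ∀ i, g i = k i ∨ (γ ≤ g i ∧ γ ≤ k i)) (hg : ∑ i, g i = 1) (hk : ∑ i, k i = 1) :
    binEntropy p - p * (1 - p) / (2 * γ) * ∑ i, (g i - k i) ^ 2 ≤ posteriorEntropy p g k := by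
  rw [posteriorEntropy_eq p hg hk, Finset.mul_sum]
  refine sub_le_sub_left (Finset.sum_le_sum fun i _ => ?_) _
  rcases hgk i with h | ⟨hgi, hki⟩
  · simp [h, jensenGap_self]
  · exact jensenGap_le hp hγ hgi hki

end Channel

/-- The probability of `true` for a bit of probability `p` that is resampled uniformly with
probability `η`. -/
def redrawBelief (η p : ℝ) : ℝ := (1 - η) * p + η / 2

theorem redrawBelief_one_sub (η p : ℝ) : redrawBelief η (1 - p) = 1 - redrawBelief η p := by
  unfold redrawBelief
  ring

theorem redrawBelief_mem_Icc {η p : ℝ} (hη : η ∈ Set.Icc (0 : ℝ) 1)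
    (hp : p ∈ Set.Icc (0 : ℝ) 1) : redrawBelief η p ∈ Set.Icc (0 : ℝ) 1 := by
  obtain ⟨⟨hη0, hη1⟩, hp0, hp1⟩ := hη, hp
  constructor <;> unfold redrawBelief <;> nlinarith

theorem log_two_mul_le_negMulLog {η : ℝ} (h0 : 0 ≤ η) (h1 : η ≤ 1 / 2) :
    log 2 * η ≤ negMulLog η := by
  rcases h0.eq_or_lt with rfl | h0
  · simp
  · have := log_le_log h0 h1
    rw [one_div, log_inv] at this
    unfold negMulLog
    nlinarith

theorem binEntropy_redrawBelief_le {η p : ℝ} (hη0 : 0 ≤ η) (hη : η ≤ 1 / 2)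
    (hp : p ∈ Set.Icc (0 : ℝ) 1) :
    binEntropy (redrawBelief η p) ≤ binEntropy p + 4 * negMulLog η := by
  have hq : 0 ≤ 1 - p := sub_nonneg.2 hp.2
  have split (x : ℝ) (hx : 0 ≤ x) : negMulLog ((1 - η) * x + η / 2) ≤
      x * negMulLog (1 - η) + (1 - η) * negMulLog x + negMulLog (η / 2) := by
    rw [← negMulLog_mul]
    exact negMulLog_add_le (mul_nonneg (by linarith) hx) (by positivity)
  have hhalf : negMulLog (η / 2) = negMulLog η / 2 + η / 2 * log 2 := by
    rw [div_eq_mul_inv, negMulLog_mul, negMulLog, negMulLog, log_inv]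
    ring
  have hstay : negMulLog (1 - η) ≤ η := by
    simpa using negMulLog_le_one_sub_self (x := 1 - η) (by linarith)
  have hE := binEntropy_nonneg hp.1 hp.2
  have hlog := log_two_mul_le_negMulLog hη0 hη
  have hp' := split p hp.1
  have hq' := split (1 - p) hq
  have := log_two_gt_d9
  simp only [binEntropy_eq_negMulLog_add_negMulLog_one_sub, ← redrawBelief_one_sub] at hE ⊢
  unfold redrawBelief
  nlinarith

theorem log_div_mul_sub_le_binEntropy_sub {p r : ℝ} (hp : p ∈ Set.Icc (0 : ℝ) 1)
    (hr : r ∈ Set.Ioo (0 : ℝ) 1) :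
    (log (1 - r) - log r) * (r - p) ≤ binEntropy r - binEntropy p := by
  have hconc := strictConcave_binEntropy.concaveOn
  have hderiv := hasDerivAt_binEntropy hr.1.ne' hr.2.ne
  have hr' := Set.Ioo_subset_Icc_self hr
  rcases lt_trichotomy p r with h | rfl | h
  · have := hconc.le_slope_of_hasDerivAt hp hr' h hderiv
    rwa [slope_def_field, le_div_iff₀ (sub_pos.2 h)] at this
  · simp
  · have := hconc.slope_le_of_hasDerivAt hr' hp h hderiv
    rw [slope_def_field, div_le_iff₀ (sub_pos.2 h)] at this
    linarith

theorem negMulLog_le_two_mul_sqrt {x : ℝ} (hx : 0 ≤ x) : negMulLog x ≤ 2 * √x := by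
  have hsqrt := negMulLog_le_one_sub_self (sqrt_nonneg x)
  have hmul : negMulLog x = 2 * (√x * negMulLog √x) := by
    conv_lhs => rw [← mul_self_sqrt hx, negMulLog_mul]
    ring
  rw [hmul]
  nlinarith [sqrt_nonneg x]

-- With `r` the redrawn belief, either `r ≤ √η / 2`, and the slope `log ((1 - r) / r)` of the
-- entropy at `r` is at least `log (1 / η) / 2`, or `r * (1 - r) ≥ √η / 4`, which dominates
-- `negMulLog η / 20` alone.
theorem le_binEntropy_redrawBelief_of_le_half {η p : ℝ} (hη0 : 0 < η) (hη : η < 1 / 2)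
    (hp0 : 0 ≤ p) (hp : p ≤ 1 / 2) :
    binEntropy p + 1 / 20 * negMulLog η ≤
      binEntropy (redrawBelief η p) + redrawBelief η p * (1 - redrawBelief η p) := by
  set r := redrawBelief η p with hr
  have hrp : r - p = η * (1 / 2 - p) := by rw [hr, redrawBelief]; ring
  have hpr : p ≤ r := by nlinarith
  have hr2 : r ≤ 1 / 2 := by nlinarith
  have hr0 : 0 < r := by nlinarith
  have htangent := log_div_mul_sub_le_binEntropy_sub ⟨hp0, by linarith⟩ ⟨hr0, by linarith⟩
  have hs0 : 0 < √η := sqrt_pos.2 hη0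
  have hs : √η < 0.71 := by nlinarith [sq_sqrt hη0.le]
  rcases le_or_gt r (√η / 2) with hsmall | hlarge
  · have hlog : -log η / 2 ≤ log (1 - r) - log r := by
      rw [neg_div, ← log_sqrt hη0.le, ← log_inv, ← log_div (by linarith) hr0.ne']
      refine log_le_log (by positivity) ?_
      rw [inv_le_comm₀ hs0 (div_pos (by linarith) hr0), inv_div, div_le_iff₀ (by linarith)]
      nlinarith
    have hgain : η * 0.14 * (-log η / 2) ≤ (r - p) * (log (1 - r) - log r) := by
      have : 0 ≤ -log η := neg_nonneg.2 (log_nonpos hη0.le (by linarith))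
      have : (0.14 : ℝ) ≤ 1 / 2 - p := by linarith
      rw [hrp]
      gcongr
    have : 0 ≤ negMulLog η := negMulLog_nonneg hη0.le (by linarith)
    have : 0 ≤ r * (1 - r) := mul_nonneg hr0.le (by linarith)
    unfold negMulLog at *
    linarith
  · have : 0 ≤ (r - p) * (log (1 - r) - log r) :=
      mul_nonneg (sub_nonneg.2 hpr) (sub_nonneg.2 (log_le_log hr0 (by linarith)))
    have : √η / 4 ≤ r * (1 - r) := by nlinarith
    linarith [negMulLog_le_two_mul_sqrt hη0.le]

theorem le_binEntropy_redrawBelief {η p : ℝ} (hη0 : 0 < η) (hη : η < 1 / 2)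
    (hp : p ∈ Set.Icc (0 : ℝ) 1) :
    binEntropy p + 1 / 20 * negMulLog η ≤
      binEntropy (redrawBelief η p) + redrawBelief η p * (1 - redrawBelief η p) := by
  rcases le_total p (1 / 2) with h | h
  · exact le_binEntropy_redrawBelief_of_le_half hη0 hη hp.1 h
  · have := le_binEntropy_redrawBelief_of_le_half hη0 hη (sub_nonneg.2 hp.2) (by linarith)
    rw [redrawBelief_one_sub, binEntropy_one_sub, binEntropy_one_sub] at this
    linarith

end Entropy

section Semicontinuity

open Filter Topology

theorem lowerSemicontinuous_measureReal {X Ω : Type*} [TopologicalSpace X]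
    [FirstCountableTopology X] [MeasurableSpace Ω] (μ : Measure Ω) [IsFiniteMeasure μ]
    {A : X → Set Ω} (hA : ∀ x, MeasurableSet (A x)) (hopen : ∀ ω, IsOpen {x | ω ∈ A x}) :
    LowerSemicontinuous fun x => μ.real (A x) := by
  intro x c hc
  have hlim : Tendsto (fun y => μ (A y ∩ A x)) (𝓝 x) (𝓝 (μ (A x))) :=
    tendsto_measure_of_tendsto_indicator_of_isFiniteMeasure (𝓝 x) μ
      (fun y => (hA y).inter (hA x)) fun ω => by
        by_cases hω : ω ∈ A x
        · filter_upwards [(hopen ω).mem_nhds hω] with y hy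
          exact iff_of_true ⟨hy, hω⟩ hω
        · exact Eventually.of_forall fun y => iff_of_false (fun h => hω h.2) hω
  have hlim' := (ENNReal.tendsto_toReal (measure_ne_top μ _)).comp hlim
  filter_upwards [hlim'.eventually_const_lt hc] with y hy
  exact hy.trans_le (measureReal_mono Set.inter_subset_left)

end Semicontinuity

section Conditioning

variable {Ω α β Y : Type*} {mΩ : MeasurableSpace Ω} [MeasurableSpace α] [MeasurableSpace β]
  [MeasurableSpace Y] [StandardBorelSpace Y] [Nonempty Y] {μ : Measure Ω} [IsFiniteMeasure μ]
  {W : Ω → α} {q : Ω → Y} {θ : Ω → β}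

theorem condDistrib_prodMk_ae_eq_of_indepFun (hW : Measurable W) (hq : Measurable q)
    (hθ : Measurable θ) (hind : IndepFun (fun ω => (W ω, q ω)) θ μ) :
    condDistrib q (fun ω => (W ω, θ ω)) μ =ᵐ[μ.map fun ω => (W ω, θ ω)]
      (condDistrib q W μ).prodMkRight β := by
  refine condDistrib_ae_eq_of_measure_eq_compProd _ hq.aemeasurable
    (Measure.ext_prod₃' fun {s t u} hs ht hu => ?_)
  have hWθ : μ.map (fun ω => (W ω, θ ω)) = (μ.map W).prod (μ.map θ) :=
    (indepFun_iff_map_prod_eq_prod_map_map hW.aemeasurable hθ.aemeasurable).1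
      (hind.comp measurable_fst measurable_id)
  have hjoint : μ.map (fun ω => ((W ω, θ ω), q ω)) ((s ×ˢ t) ×ˢ u) =
      μ (W ⁻¹' s ∩ q ⁻¹' u) * μ (θ ⁻¹' t) := by
    rw [Measure.map_apply (by fun_prop) ((hs.prod ht).prod hu),
      ← Set.mk_preimage_prod, ← hind.measure_inter_preimage_eq_mul _ _ (hs.prod hu) ht]
    congr 1
    ext ω
    simp only [Set.mem_preimage, Set.mem_prod, Set.mem_inter_iff]
    tauto
  rw [hjoint, Measure.compProd_apply_prod (hs.prod ht) hu, hWθ]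
  have := Kernel.measurable_coe (condDistrib q W μ) hu
  simp only [Kernel.prodMkRight_apply]
  rw [← Measure.prod_restrict, lintegral_prod _ (by fun_prop)]
  simp only [lintegral_const, Measure.restrict_apply_univ, Measure.map_apply hθ ht]
  rw [lintegral_mul_const _ this, ← Measure.compProd_apply_prod hs hu,
    compProd_map_condDistrib hq.aemeasurable, Measure.map_apply (by fun_prop) (hs.prod hu)]
  rfl

theorem condExp_prodMk_ae_eq_of_indepFun (hW : Measurable W) (hq : Measurable q)
    (hθ : Measurable θ) (hind : IndepFun (fun ω => (W ω, q ω)) θ μ) {f : Y → β → ℝ}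
    (hf : Measurable f.uncurry) (hint : Integrable (fun ω => f (q ω) (θ ω)) μ) :
    μ[fun ω => f (q ω) (θ ω) | MeasurableSpace.comap (fun ω => (W ω, θ ω)) inferInstance]
      =ᵐ[μ] fun ω => ∫ y, f y (θ ω) ∂condDistrib q W μ (W ω) := by
  have hcond := condDistrib_prodMk_ae_eq_of_indepFun hW hq hθ hind
  have hf' : StronglyMeasurable fun x : (α × β) × Y => f x.2 x.1.2 :=
    (hf.comp (measurable_snd.prodMk (measurable_snd.comp measurable_fst))).stronglyMeasurable
  filter_upwards [ae_of_ae_map (hW.prodMk hθ).aemeasurable hcond,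
    condExp_prod_ae_eq_integral_condDistrib (hW.prodMk hθ) hq.aemeasurable hf' hint] with ω h h'
  rw [h', h, Kernel.prodMkRight_apply]

end Conditioning

section Posterior

variable {Ω α : Type*} {mΩ : MeasurableSpace Ω} [MeasurableSpace α] {μ : Measure Ω}
  [IsFiniteMeasure μ] {W : Ω → α} {q : Ω → Bool}

/-- The posterior probability of `q = true` given `W = a`; it is a junk value in `[0, 1]` if
`W = a` has probability zero. -/
def posterior (μ : Measure Ω) [IsFiniteMeasure μ] (W : Ω → α) (q : Ω → Bool) (a : α) : ℝ :=
  (condDistrib q W μ a).real {true}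

theorem posterior_mem_Icc (a : α) : posterior μ W q a ∈ Set.Icc (0 : ℝ) 1 :=
  ⟨measureReal_nonneg, measureReal_le_one⟩

theorem condDistrib_real_false (a : α) :
    (condDistrib q W μ a).real {false} = 1 - posterior μ W q a := by
  rw [posterior, ← probReal_compl_eq_one_sub (.singleton _)]
  congr 1
  ext b
  cases b <;> simp

theorem integral_condDistrib_bool (f : Bool → ℝ) (a : α) :
    ∫ b, f b ∂condDistrib q W μ a =
      (1 - posterior μ W q a) * f false + posterior μ W q a * f true := by
  rw [integral_fintype .of_finite, Fintype.sum_bool, condDistrib_real_false, add_comm]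
  rfl

variable [MeasurableSingletonClass α]

theorem measureReal_preimage_inter_eq_mul_condDistrib (hW : Measurable W) (hq : Measurable q)
    (a : α) (b : Bool) :
    μ.real (W ⁻¹' {a} ∩ q ⁻¹' {b}) =
      μ.real (W ⁻¹' {a}) * (condDistrib q W μ a).real {b} := by
  have hjoint : μ.map (fun ω => (W ω, q ω)) ({a} ×ˢ {b}) = μ (W ⁻¹' {a} ∩ q ⁻¹' {b}) := by
    rw [Measure.map_apply (hW.prodMk hq) ((measurableSet_singleton a).prod (.singleton b)),
      Set.mk_preimage_prod]
  rw [← compProd_map_condDistrib hq.aemeasurable, Measure.compProd_apply_prod (.singleton a)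
    (.singleton b), lintegral_singleton, Measure.map_apply hW (.singleton a)] at hjoint
  simp only [Measure.real, ← hjoint, ENNReal.toReal_mul, mul_comm]

theorem measureReal_preimage_inter_true (hW : Measurable W) (hq : Measurable q) (a : α) :
    μ.real (W ⁻¹' {a} ∩ q ⁻¹' {true}) = μ.real (W ⁻¹' {a}) * posterior μ W q a :=
  measureReal_preimage_inter_eq_mul_condDistrib hW hq a true

theorem measureReal_preimage_inter_false (hW : Measurable W) (hq : Measurable q) (a : α) :
    μ.real (W ⁻¹' {a} ∩ q ⁻¹' {false}) = μ.real (W ⁻¹' {a}) * (1 - posterior μ W q a) := by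
  rw [measureReal_preimage_inter_eq_mul_condDistrib hW hq, condDistrib_real_false]

end Posterior

section ConditionalEntropy

variable {Ω α : Type*} {mΩ : MeasurableSpace Ω} [Fintype α] [MeasurableSpace α]
  {μ : Measure Ω} {W : Ω → α} {q : Ω → Bool}

/-- The conditional entropy of the bit `q` given `W`. -/
def condEntropy (μ : Measure Ω) [IsFiniteMeasure μ] (W : Ω → α) (q : Ω → Bool) : ℝ :=
  ∑ a, μ.real (W ⁻¹' {a}) * Real.binEntropy (posterior μ W q a)

/-- The expected distance between the bit `q` and its conditional mean given `W`: a bit of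
probability `p` is at expected distance `p * (1 - p) + (1 - p) * p` from `p`. -/
def condError (μ : Measure Ω) [IsFiniteMeasure μ] (W : Ω → α) (q : Ω → Bool) : ℝ :=
  ∑ a, μ.real (W ⁻¹' {a}) * (2 * (posterior μ W q a * (1 - posterior μ W q a)))

theorem condEntropy_nonneg [IsFiniteMeasure μ] : 0 ≤ condEntropy μ W q :=
  Finset.sum_nonneg fun a _ => mul_nonneg measureReal_nonneg
    (Real.binEntropy_nonneg (posterior_mem_Icc a).1 (posterior_mem_Icc a).2)

variable [MeasurableSingletonClass α]

theorem sum_probReal_preimage_singleton [IsProbabilityMeasure μ] (hW : Measurable W) :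
    ∑ a, μ.real (W ⁻¹' {a}) = 1 := by
  rw [sum_measureReal_preimage_singleton _ fun a _ => hW (.singleton a)]
  simp

theorem condEntropy_le_log_two [IsProbabilityMeasure μ] (hW : Measurable W) :
    condEntropy μ W q ≤ Real.log 2 := by
  calc condEntropy μ W q ≤ ∑ a, μ.real (W ⁻¹' {a}) * Real.log 2 :=
        Finset.sum_le_sum fun a _ =>
          mul_le_mul_of_nonneg_left Real.binEntropy_le_log_two measureReal_nonneg
    _ = Real.log 2 := by
        rw [← Finset.sum_mul, sum_probReal_preimage_singleton hW, one_mul]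

variable [IsFiniteMeasure μ]

theorem condEntropy_eq_sum_massEntropy (hW : Measurable W) (hq : Measurable q) :
    condEntropy μ W q = ∑ a, massEntropy (μ.real (W ⁻¹' {a} ∩ q ⁻¹' {true}))
      (μ.real (W ⁻¹' {a} ∩ q ⁻¹' {false})) := by
  simp only [condEntropy, measureReal_preimage_inter_true hW hq,
    measureReal_preimage_inter_false hW hq, massEntropy_mul, massEntropy_one_sub]

theorem integral_norm_condExp_sub_value (hW : Measurable W) (hq : Measurable q) :
    ∫ ω, ‖(μ[fun ω' => value (q ω') | MeasurableSpace.comap W inferInstance]) ω -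
      value (q ω)‖ ∂μ = condError μ W q := by
  have hint : Integrable (fun ω => value (q ω)) μ :=
    (Integrable.of_finite (μ := μ.map q) (f := value)).comp_measurable hq
  have hcond := condExp_ae_eq_integral_condDistrib (F := ℝ) hW hq.aemeasurable
    (f := value) (measurable_of_finite _).stronglyMeasurable hint
  let error (x : α × Bool) : ℝ := ‖posterior μ W q x.1 - value x.2‖
  have hmap : ∫ x, error x ∂μ.map (fun ω => (W ω, q ω)) = ∫ ω, error (W ω, q ω) ∂μ :=
    integral_map (hW.prodMk hq).aemeasurable (measurable_of_finite error).aestronglyMeasurable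
  have hmass (a : α) (b : Bool) : (μ.map fun ω => (W ω, q ω)).real {(a, b)} =
      μ.real (W ⁻¹' {a} ∩ q ⁻¹' {b}) := by
    rw [map_measureReal_apply (hW.prodMk hq) (.singleton _), ← Set.singleton_prod_singleton,
      Set.mk_preimage_prod]
  calc _ = ∫ ω, error (W ω, q ω) ∂μ := by
        refine integral_congr_ae ?_
        filter_upwards [hcond] with ω hω
        rw [hω, integral_condDistrib_bool]
        simp [value, error]
    _ = condError μ W q := by
        rw [← hmap, integral_fintype .of_finite, Fintype.sum_prod_type]
        refine Finset.sum_congr rfl fun a _ => ?_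
        obtain ⟨hp0, hp1⟩ := posterior_mem_Icc (μ := μ) (W := W) (q := q) a
        simp only [Fintype.sum_bool, hmass, measureReal_preimage_inter_true hW hq,
          measureReal_preimage_inter_false hW hq, error, value, smul_eq_mul, Real.norm_eq_abs,
          if_true, Bool.false_eq_true, if_false, sub_zero, abs_of_nonneg hp0,
          abs_of_nonpos (sub_nonpos.2 hp1)]
        ring

end ConditionalEntropy

section Updates

theorem indepFun_prodMk_of_indepFun_prodMk {Ω α β γ : Type*} {mΩ : MeasurableSpace Ω}
    [MeasurableSpace α] [MeasurableSpace β] [MeasurableSpace γ] {μ : Measure Ω}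
    [IsProbabilityMeasure μ] {A : Ω → α} {B : Ω → β} {C : Ω → γ} (hA : Measurable A)
    (hB : Measurable B) (hC : Measurable C) (hABC : IndepFun A (fun ω => (B ω, C ω)) μ)
    (hBC : IndepFun B C μ) : IndepFun (fun ω => (A ω, B ω)) C μ := by
  have hAB : IndepFun A B μ := hABC.comp measurable_id measurable_fst
  rw [indepFun_iff_map_prod_eq_prod_map_map (by fun_prop) (by fun_prop)] at *
  rw [hAB, ← MeasurableEquiv.prodAssoc.map_measurableEquiv_injective.eq_iff,
    Measure.prodAssoc_prod, ← hBC, ← hABC, Measure.map_map (by fun_prop) (by fun_prop)]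
  rfl

variable {Ω α : Type*} {mΩ : MeasurableSpace Ω} [MeasurableSpace α] [MeasurableSingletonClass α]
  {μ : Measure Ω} {W : Ω → α} {q : Ω → Bool} {ζ ξ : Type*} [MeasurableSpace ξ] {Z : Ω → ζ}
  {N : Ω → ξ} {φ : α → Bool → ξ → ζ}

theorem measureReal_preimage_prodMk_inter (hN : Measurable N)
    (hind : IndepFun (fun ω => (W ω, q ω)) N μ)
    (hφ : ∀ a b z, MeasurableSet {x | φ a b x = z})
    (hZ : Z =ᵐ[μ] fun ω => φ (W ω) (q ω) (N ω)) (a : α) (b : Bool) (z : ζ) :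
    μ.real ((fun ω => (W ω, Z ω)) ⁻¹' {(a, z)} ∩ q ⁻¹' {b}) =
      μ.real (W ⁻¹' {a} ∩ q ⁻¹' {b}) * (μ.map N).real {x | φ a b x = z} := by
  have hset : ((fun ω => (W ω, Z ω)) ⁻¹' {(a, z)} ∩ q ⁻¹' {b} : Set Ω) =ᵐ[μ]
      ((fun ω => (W ω, q ω)) ⁻¹' ({a} ×ˢ {b}) ∩ N ⁻¹' {x | φ a b x = z} : Set Ω) := by
    refine Filter.eventuallyEq_set.2 ?_
    filter_upwards [hZ] with ω hω
    simp only [Set.mem_inter_iff, Set.mem_preimage, Set.mem_singleton_iff, Prod.mk.injEq, hω,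
      Set.mem_prod, Set.mem_ofPred_eq]
    constructor
    · rintro ⟨⟨rfl, h⟩, rfl⟩
      exact ⟨⟨rfl, rfl⟩, h⟩
    · rintro ⟨⟨rfl, rfl⟩, h⟩
      exact ⟨⟨rfl, h⟩, rfl⟩
  rw [measureReal_congr hset, map_measureReal_apply hN (hφ a b z), Measure.real,
    hind.measure_inter_preimage_eq_mul _ _ ((measurableSet_singleton a).prod (.singleton b))
      (hφ a b z), ENNReal.toReal_mul, Set.mk_preimage_prod]
  rfl

variable [IsFiniteMeasure μ]

theorem condEntropy_equiv_comp {β : Type*} [Fintype α] [Fintype β] [MeasurableSpace β]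
    [MeasurableSingletonClass β] (e : α ≃ β) (he : Measurable e) (hW : Measurable W)
    (hq : Measurable q) : condEntropy μ (e ∘ W) q = condEntropy μ W q := by
  rw [condEntropy_eq_sum_massEntropy (he.comp hW) hq, condEntropy_eq_sum_massEntropy hW hq,
    ← e.sum_comp]
  have hpre (a : α) : (e ∘ W) ⁻¹' {e a} = W ⁻¹' {a} := by
    ext ω
    exact e.apply_eq_iff_eq
  simp only [hpre]

theorem posterior_redraw {X S : Ω → Bool} (hW : Measurable W) (hq : Measurable q)
    (hX : Measurable X) (hS : Measurable S)
    (hind : IndepFun (fun ω => (W ω, q ω)) (fun ω => (X ω, S ω)) μ) {a : α}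
    (ha : μ.real (W ⁻¹' {a}) ≠ 0) :
    posterior μ W (fun ω => if S ω then X ω else q ω) a =
      μ.real (S ⁻¹' {false}) * posterior μ W q a + μ.real (X ⁻¹' {true} ∩ S ⁻¹' {true}) := by
  have hq' : Measurable fun ω => if S ω then X ω else q ω :=
    hX.ite (hS (.singleton true)) hq
  have hmul {s : Set (α × Bool)} {t : Set (Bool × Bool)} (hs : MeasurableSet s) :
      μ.real ((fun ω => (W ω, q ω)) ⁻¹' s ∩ (fun ω => (X ω, S ω)) ⁻¹' t) =
        μ.real ((fun ω => (W ω, q ω)) ⁻¹' s) * μ.real ((fun ω => (X ω, S ω)) ⁻¹' t) := by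
    simp only [Measure.real, hind.measure_inter_preimage_eq_mul _ _ hs .of_discrete,
      ENNReal.toReal_mul]
  have hkeep := hmul (t := Set.univ ×ˢ {false})
    ((measurableSet_singleton a).prod (.singleton true))
  have hdraw := hmul (t := {true} ×ˢ {true}) ((measurableSet_singleton a).prod .univ)
  simp only [Set.mk_preimage_prod, Set.preimage_univ, Set.inter_univ, Set.univ_inter] at hkeep hdraw
  have hsplit : W ⁻¹' {a} ∩ (fun ω => if S ω then X ω else q ω) ⁻¹' {true} =
      W ⁻¹' {a} ∩ q ⁻¹' {true} ∩ S ⁻¹' {false} ∪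
        W ⁻¹' {a} ∩ (X ⁻¹' {true} ∩ S ⁻¹' {true}) := by
    ext ω
    cases h : S ω <;> simp [h]
  have hdisj : Disjoint (W ⁻¹' {a} ∩ q ⁻¹' {true} ∩ S ⁻¹' {false})
      (W ⁻¹' {a} ∩ (X ⁻¹' {true} ∩ S ⁻¹' {true})) :=
    Set.disjoint_left.2 fun ω h h' => by simp_all
  have hmass := measureReal_preimage_inter_true (μ := μ) hW hq' a
  rw [hsplit, measureReal_union hdisj
    ((hW (.singleton a)).inter ((hX (.singleton true)).inter (hS (.singleton true)))), hkeep,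
    hdraw, measureReal_preimage_inter_true hW hq] at hmass
  apply mul_left_cancel₀ ha
  rw [← hmass]
  ring

theorem condEntropy_prodMk [Fintype α] [Fintype ζ] [MeasurableSpace ζ]
    [MeasurableSingletonClass ζ] (hW : Measurable W) (hq : Measurable q) (hN : Measurable N)
    (hZm : Measurable Z) (hind : IndepFun (fun ω => (W ω, q ω)) N μ)
    (hφ : ∀ a b z, MeasurableSet {x | φ a b x = z})
    (hZ : Z =ᵐ[μ] fun ω => φ (W ω) (q ω) (N ω)) :
    condEntropy μ (fun ω => (W ω, Z ω)) q =
      ∑ a, μ.real (W ⁻¹' {a}) * posteriorEntropy (posterior μ W q a)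
        (fun z => (μ.map N).real {x | φ a true x = z})
        (fun z => (μ.map N).real {x | φ a false x = z}) := by
  rw [condEntropy_eq_sum_massEntropy (hW.prodMk hZm) hq, Fintype.sum_prod_type]
  refine Finset.sum_congr rfl fun a _ => ?_
  rw [posteriorEntropy, Finset.mul_sum]
  refine Finset.sum_congr rfl fun z _ => ?_
  rw [measureReal_preimage_prodMk_inter hN hind hφ hZ,
    measureReal_preimage_prodMk_inter hN hind hφ hZ,
    measureReal_preimage_inter_true hW hq, measureReal_preimage_inter_false hW hq,
    mul_assoc, mul_assoc, massEntropy_mul]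

end Updates

namespace Market

section Reviews

variable {Θ E F : Type*} [MeasurableSpace Θ] [MeasurableSpace E] (M : Market Θ E F)

instance : IsProbabilityMeasure M.prefLaw := M.prefLaw_prob

instance : IsProbabilityMeasure M.noiseLaw := M.noiseLaw_prob

open Classical in
/-- The review left by a consumer who believes that the quality is `H` with probability `p`, when
the quality is `q` and the preference and the noise are `x`; `none` stands for no purchase. -/
def response (p : ℝ) (q : Quality) (x : Θ × E) : Option F :=
  if 0 < M.expectedReward p x.1 then some (M.feedback q x.1 x.2) else none

/-- The law of the review `M.response p q`. -/
def reviewProb (p : ℝ) (q : Quality) (z : Option F) : ℝ :=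
  (M.prefLaw.prod M.noiseLaw).real {x | M.response p q x = z}

theorem setOf_response_eq_some (p : ℝ) (q : Quality) (z : F) :
    {x | M.response p q x = some z} =
      {x | 0 < M.expectedReward p x.1 ∧ M.feedback q x.1 x.2 = z} := by
  ext x
  by_cases h : 0 < M.expectedReward p x.1 <;> simp [response, h]

theorem setOf_response_eq_none (p : ℝ) (q : Quality) :
    {x | M.response p q x = none} = {x | M.expectedReward p x.1 ≤ 0} := by
  ext x
  by_cases h : 0 < M.expectedReward p x.1 <;> simp [response, h, le_of_not_gt]

theorem measurable_expectedReward (p : ℝ) : Measurable (M.expectedReward p) :=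
  ((M.reward_measurable L).const_mul _).add ((M.reward_measurable H).const_mul _)

theorem measurableSet_buy_and_feedback_eq (p : ℝ) (q : Quality) (z : F) :
    MeasurableSet {x : Θ × E | 0 < M.expectedReward p x.1 ∧ M.feedback q x.1 x.2 = z} :=
  (measurableSet_lt measurable_const ((M.measurable_expectedReward p).comp measurable_fst)).inter
    (M.feedback_measurable q z)

theorem measurableSet_response_eq (p : ℝ) (q : Quality) (z : Option F) :
    MeasurableSet {x | M.response p q x = z} := by
  cases z with
  | none =>
    rw [setOf_response_eq_none]
    exact measurableSet_le ((M.measurable_expectedReward p).comp measurable_fst) measurable_const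
  | some z =>
    rw [setOf_response_eq_some]
    exact M.measurableSet_buy_and_feedback_eq p q z

theorem reviewProb_some (p : ℝ) (q : Quality) (z : F) :
    M.reviewProb p q (some z) = M.G z p q := by
  rw [reviewProb, setOf_response_eq_some, G]

theorem reviewProb_none (p : ℝ) (q q' : Quality) :
    M.reviewProb p q none = M.reviewProb p q' none := by
  simp only [reviewProb, setOf_response_eq_none]

theorem reviewProb_nonneg (p : ℝ) (q : Quality) : 0 ≤ M.reviewProb p q :=
  fun _ => measureReal_nonneg

theorem G_le_one (z : F) (p : ℝ) (q : Quality) : M.G z p q ≤ 1 := measureReal_le_one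

theorem G_nonneg (z : F) (p : ℝ) (q : Quality) : 0 ≤ M.G z p q := measureReal_nonneg

theorem lowerSemicontinuous_G (z : F) (q : Quality) :
    LowerSemicontinuous fun p => M.G z p q := by
  refine lowerSemicontinuous_measureReal _
    (fun p => M.measurableSet_buy_and_feedback_eq p q z) fun x => ?_
  have hcont : Continuous fun p => M.expectedReward p x.1 := by
    unfold expectedReward
    fun_prop
  exact (isOpen_lt continuous_const hcont).and isOpen_const

theorem exists_pos_le_G [Finite F] (hpos : ∀ p ∈ Set.Icc (0 : ℝ) 1, ∀ z q, 0 < M.G z p q) :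
    ∃ γ > 0, ∀ p ∈ Set.Icc (0 : ℝ) 1, ∀ z q, γ ≤ M.G z p q := by
  have hmin (z : F) (q : Quality) :
      ∀ᶠ γ in nhdsWithin 0 (Set.Ioi 0), ∀ p ∈ Set.Icc (0 : ℝ) 1, γ ≤ M.G z p q := by
    obtain ⟨p₀, hp₀, hp₀min⟩ := (M.lowerSemicontinuous_G z q).lowerSemicontinuousOn _
      |>.exists_isMinOn (Set.nonempty_Icc.2 zero_le_one) isCompact_Icc
    filter_upwards [Ioc_mem_nhdsGT (hpos p₀ hp₀ z q)] with γ hγ p hp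
    exact hγ.2.trans (hp₀min hp)
  obtain ⟨γ, hγ, hγ0⟩ := ((Filter.eventually_all.2 fun z =>
    Filter.eventually_all.2 (hmin z)).and self_mem_nhdsWithin).exists
  exact ⟨γ, hγ0, fun p hp z q => hγ z q p hp⟩

variable [Fintype F]

theorem sum_reviewProb (p : ℝ) (q : Quality) : ∑ z, M.reviewProb p q z = 1 := by
  simp only [reviewProb]
  have := sum_measureReal_preimage_singleton (μ := M.prefLaw.prod M.noiseLaw) Finset.univ
    (f := M.response p q) fun z _ => M.measurableSet_response_eq p q z
  simpa [Set.preimage] using this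

theorem sum_sq_reviewProb_sub (p : ℝ) :
    ∑ z, (M.reviewProb p H z - M.reviewProb p L z) ^ 2 =
      ∑ z, (M.G z p H - M.G z p L) ^ 2 := by
  simp [Fintype.sum_option, reviewProb_some, M.reviewProb_none p H L]

theorem sum_sq_G_sub_le_card (p : ℝ) :
    ∑ z, (M.G z p H - M.G z p L) ^ 2 ≤ Fintype.card F := by
  have hle (z : F) : (M.G z p H - M.G z p L) ^ 2 ≤ 1 := by
    rw [sq_le_one_iff_abs_le_one, abs_sub_le_iff]
    constructor <;>
      linarith [M.G_nonneg z p H, M.G_le_one z p H, M.G_nonneg z p L, M.G_le_one z p L]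
  simpa using Finset.sum_le_sum fun z (_ : z ∈ Finset.univ) => hle z

theorem delta_nonneg : 0 ≤ M.delta :=
  Real.iInf_nonneg fun _ => Finset.sum_nonneg fun _ _ => abs_nonneg _

theorem delta_le {p : ℝ} (hp : p ∈ Set.Icc (0 : ℝ) 1) :
    M.delta ≤ ∑ z, |M.G z p L - M.G z p H| :=
  ciInf_le ⟨0, Set.forall_mem_range.2 fun _ => Finset.sum_nonneg fun _ _ => abs_nonneg _⟩
    (⟨p, hp⟩ : Set.Icc (0 : ℝ) 1)

theorem nonempty_of_delta_pos (h : 0 < M.delta) : Nonempty F := by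
  by_contra hF
  rw [not_nonempty_iff] at hF
  simp [delta] at h

theorem delta_sq_div_card_le {p : ℝ} (hp : p ∈ Set.Icc (0 : ℝ) 1) :
    M.delta ^ 2 / Fintype.card F ≤ ∑ z, (M.G z p H - M.G z p L) ^ 2 := by
  refine div_le_of_le_mul₀ (Nat.cast_nonneg _) (Finset.sum_nonneg fun _ _ => sq_nonneg _) ?_
  calc M.delta ^ 2 ≤ (∑ z, |M.G z p L - M.G z p H|) ^ 2 :=
        pow_le_pow_left₀ M.delta_nonneg (M.delta_le hp) 2
    _ ≤ Fintype.card F * ∑ z, |M.G z p L - M.G z p H| ^ 2 := sq_sum_le_card_mul_sum_sq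
    _ = _ := by simp only [sq_abs, sub_sq_comm, mul_comm]

theorem posteriorEntropy_reviewProb_le {p : ℝ} (hp : p ∈ Set.Icc (0 : ℝ) 1) :
    posteriorEntropy p (M.reviewProb p H) (M.reviewProb p L) ≤
      Real.binEntropy p - M.delta ^ 2 / Fintype.card F / 4 * (2 * (p * (1 - p))) := by
  have h := posteriorEntropy_le hp (M.reviewProb_nonneg p H) (M.reviewProb_nonneg p L)
    (M.sum_reviewProb p H) (M.sum_reviewProb p L)
  have hvar : 0 ≤ p * (1 - p) := mul_nonneg hp.1 (sub_nonneg.2 hp.2)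
  rw [sum_sq_reviewProb_sub] at h
  nlinarith [M.delta_sq_div_card_le hp]

theorem le_posteriorEntropy_reviewProb {p γ : ℝ} (hp : p ∈ Set.Icc (0 : ℝ) 1) (hγ : 0 < γ)
    (hG : ∀ z q, γ ≤ M.G z p q) :
    Real.binEntropy p - Fintype.card F / γ / 4 * (2 * (p * (1 - p))) ≤
      posteriorEntropy p (M.reviewProb p H) (M.reviewProb p L) := by
  have hgk : ∀ z, M.reviewProb p H z = M.reviewProb p L z ∨
      (γ ≤ M.reviewProb p H z ∧ γ ≤ M.reviewProb p L z) := by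
    rintro (_ | z)
    · exact .inl (M.reviewProb_none p H L)
    · simp only [reviewProb_some]
      exact .inr ⟨hG z H, hG z L⟩
  have h := le_posteriorEntropy hp hγ hgk (M.sum_reviewProb p H) (M.sum_reviewProb p L)
  have hvar : 0 ≤ p * (1 - p) / (2 * γ) :=
    div_nonneg (mul_nonneg hp.1 (sub_nonneg.2 hp.2)) (by positivity)
  have hbound := mul_le_mul_of_nonneg_left (M.sum_sq_G_sub_le_card p) hvar
  rw [sum_sq_reviewProb_sub] at h
  refine le_trans (le_of_eq_of_le ?_ (sub_le_sub_left hbound _)) h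
  ring

end Reviews

end Market

section Laws

theorem coinLaw_real_true {p : ℝ} (hp : 0 ≤ p) : (coinLaw p).real {true} = p := by
  simp [coinLaw, measureReal_def, hp]

theorem coinLaw_real_false {p : ℝ} (hp : p ≤ 1) : (coinLaw p).real {false} = 1 - p := by
  simp [coinLaw, measureReal_def, hp]

theorem isProbabilityMeasure_coinLaw {p : ℝ} (hp : p ∈ Set.Icc (0 : ℝ) 1) :
    IsProbabilityMeasure (coinLaw p) := by
  constructor
  simp only [coinLaw, Measure.add_apply, Measure.smul_apply, measure_univ, smul_eq_mul, mul_one]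
  rw [← ENNReal.ofReal_add hp.1 (sub_nonneg.2 hp.2), add_sub_cancel, ENNReal.ofReal_one]

instance : IsProbabilityMeasure prior := isProbabilityMeasure_coinLaw (by norm_num)

section Product

variable {Ω α β : Type*} {mΩ : MeasurableSpace Ω} [MeasurableSpace α] [MeasurableSpace β]
  {μ : Measure Ω} {A : Ω → α} {B : Ω → β} {ρ : Measure α} {σ : Measure β}

theorem map_fst_eq_of_map_prodMk [IsProbabilityMeasure σ] (hB : Measurable B)
    (h : μ.map (fun ω => (A ω, B ω)) = ρ.prod σ) : μ.map A = ρ := by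
  rw [← Measure.fst_map_prodMk hB, h, Measure.fst_prod]

theorem map_snd_eq_of_map_prodMk [IsProbabilityMeasure ρ] [SFinite σ] (hA : Measurable A)
    (h : μ.map (fun ω => (A ω, B ω)) = ρ.prod σ) : μ.map B = σ := by
  rw [← Measure.snd_map_prodMk hA, h, Measure.snd_prod]

theorem indepFun_of_map_prodMk [IsFiniteMeasure μ] [IsProbabilityMeasure ρ]
    [IsProbabilityMeasure σ] (hA : Measurable A) (hB : Measurable B)
    (h : μ.map (fun ω => (A ω, B ω)) = ρ.prod σ) : IndepFun A B μ := by
  rw [indepFun_iff_map_prod_eq_prod_map_map hA.aemeasurable hB.aemeasurable, h,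
    map_fst_eq_of_map_prodMk hB h, map_snd_eq_of_map_prodMk hA h]

end Product

end Laws

namespace Inputs

variable {Θ E F : Type*} [MeasurableSpace Θ] [MeasurableSpace E] {M : Market Θ E F} {η : ℝ}
  {Ω : Type*} [MeasurableSpace Ω] {μ : Measure Ω} (I : Inputs M η μ)

section Redraw

/-- The preference and the noise of time `t`. -/
def shock (t : ℕ) (ω : Ω) : Θ × E := (I.θ t ω, I.ε t ω)

/-- All the inputs of time `t`. -/
def draw (t : ℕ) (ω : Ω) : Quality × Bool × Θ × E := (I.X t ω, I.S t ω, I.shock t ω)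

theorem measurable_shock (t : ℕ) : Measurable (I.shock t) :=
  (I.θ_measurable t).prodMk (I.ε_measurable t)

theorem measurable_draw (t : ℕ) : Measurable (I.draw t) :=
  (I.X_measurable t).prodMk ((I.S_measurable t).prodMk (I.measurable_shock t))

variable (hη : η ∈ Set.Icc (0 : ℝ) 1)
include hη

theorem map_X (t : ℕ) : μ.map (I.X t) = prior :=
  have := isProbabilityMeasure_coinLaw hη
  map_fst_eq_of_map_prodMk ((I.S_measurable t).prodMk (I.measurable_shock t)) (I.law t)

theorem map_S_shock (t : ℕ) :
    μ.map (fun ω => (I.S t ω, I.shock t ω)) = (coinLaw η).prod (M.prefLaw.prod M.noiseLaw) :=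
  have := isProbabilityMeasure_coinLaw hη
  map_snd_eq_of_map_prodMk (I.X_measurable t) (I.law t)

theorem map_S (t : ℕ) : μ.map (I.S t) = coinLaw η :=
  map_fst_eq_of_map_prodMk (I.measurable_shock t) (I.map_S_shock hη t)

theorem map_shock (t : ℕ) : μ.map (I.shock t) = M.prefLaw.prod M.noiseLaw :=
  have := isProbabilityMeasure_coinLaw hη
  map_snd_eq_of_map_prodMk (I.S_measurable t) (I.map_S_shock hη t)

theorem map_θ (t : ℕ) : μ.map (I.θ t) = M.prefLaw :=
  map_fst_eq_of_map_prodMk (I.ε_measurable t) (I.map_shock hη t)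

theorem measureReal_X_true (t : ℕ) : μ.real (I.X t ⁻¹' {true}) = 1 / 2 := by
  rw [← map_measureReal_apply (I.X_measurable t) (.singleton true), I.map_X hη]
  exact coinLaw_real_true (by norm_num)

theorem measureReal_S_false (t : ℕ) : μ.real (I.S t ⁻¹' {false}) = 1 - η := by
  rw [← map_measureReal_apply (I.S_measurable t) (.singleton false), I.map_S hη,
    coinLaw_real_false hη.2]

variable [IsProbabilityMeasure μ]

theorem indepFun_X_S_shock (t : ℕ) : IndepFun (I.X t) (fun ω => (I.S t ω, I.shock t ω)) μ :=
  have := isProbabilityMeasure_coinLaw hη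
  indepFun_of_map_prodMk (I.X_measurable t) ((I.S_measurable t).prodMk (I.measurable_shock t))
    (I.law t)

theorem indepFun_X_S_prodMk_shock (t : ℕ) :
    IndepFun (fun ω => (I.X t ω, I.S t ω)) (I.shock t) μ :=
  have := isProbabilityMeasure_coinLaw hη
  indepFun_prodMk_of_indepFun_prodMk (I.X_measurable t) (I.S_measurable t) (I.measurable_shock t)
    (I.indepFun_X_S_shock hη t)
    (indepFun_of_map_prodMk (I.S_measurable t) (I.measurable_shock t) (I.map_S_shock hη t))

theorem measureReal_X_true_inter_S_true (t : ℕ) :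
    μ.real (I.X t ⁻¹' {true} ∩ I.S t ⁻¹' {true}) = η / 2 := by
  have hXS : IndepFun (I.X t) (I.S t) μ :=
    (I.indepFun_X_S_shock hη t).comp measurable_id measurable_fst
  rw [Measure.real, hXS.measure_inter_preimage_eq_mul _ _ (.singleton true) (.singleton true),
    ENNReal.toReal_mul]
  change μ.real _ * μ.real _ = _
  rw [I.measureReal_X_true hη, ← map_measureReal_apply (I.S_measurable t) (.singleton true),
    I.map_S hη, coinLaw_real_true hη.1]
  ring

end Redraw

section Past

/-- The information of the inputs up to time `t`. -/
@[reducible] def past (t : ℕ) : MeasurableSpace Ω :=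
  ⨆ i ∈ Set.Iic t, MeasurableSpace.comap (I.draw i) inferInstance

theorem past_le (t : ℕ) : I.past t ≤ ‹MeasurableSpace Ω› :=
  iSup₂_le fun i _ => (I.measurable_draw i).comap_le

theorem past_mono {s t : ℕ} (h : s ≤ t) : I.past s ≤ I.past t :=
  biSup_mono fun _ hi => le_trans (Set.mem_Iic.1 hi) h

theorem measurable_past_draw (t : ℕ) : Measurable[I.past t] (I.draw t) :=
  (comap_measurable _).mono
    (le_iSup₂_of_le (f := fun i (_ : i ∈ Set.Iic t) =>
      MeasurableSpace.comap (I.draw i) inferInstance) t Set.self_mem_Iic le_rfl) le_rfl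

theorem measurable_past_shock (t : ℕ) : Measurable[I.past t] (I.shock t) :=
  (measurable_snd.comp measurable_snd).comp (I.measurable_past_draw t)

theorem measurable_past_Q (t : ℕ) : Measurable[I.past t] (I.Q t) := by
  induction t with
  | zero => exact measurable_fst.comp (I.measurable_past_draw 0)
  | succ t ih =>
    have hdraw := I.measurable_past_draw (t + 1)
    have hS : Measurable[I.past (t + 1)] (I.S (t + 1)) :=
      measurable_fst.comp (measurable_snd.comp hdraw)
    exact Measurable.ite (hS (measurableSet_singleton true)) (measurable_fst.comp hdraw)
      (ih.mono (I.past_mono t.le_succ) le_rfl)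

theorem measurable_Q (t : ℕ) : Measurable (I.Q t) :=
  (I.measurable_past_Q t).mono (I.past_le t) le_rfl

open Classical in
theorem integrable_reward_Q_θ (hη : η ∈ Set.Icc (0 : ℝ) 1) (t : ℕ) :
    Integrable (fun ω => M.reward (I.Q t ω) (I.θ t ω)) μ := by
  have hr (q : Quality) : Integrable (fun ω => M.reward q (I.θ t ω)) μ := by
    have hq := M.reward_integrable q
    rw [← I.map_θ hη t] at hq
    exact hq.comp_measurable (I.θ_measurable t)
  have hsplit : (fun ω => M.reward (I.Q t ω) (I.θ t ω)) =
      (I.Q t ⁻¹' {true}).piecewise (fun ω => M.reward H (I.θ t ω))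
        (fun ω => M.reward L (I.θ t ω)) := by
    funext ω
    cases h : I.Q t ω <;> simp [Set.piecewise, h]
  rw [hsplit]
  exact .piecewise (I.measurable_Q t (.singleton true)) (hr H).integrableOn (hr L).integrableOn

theorem history_le_past {t : ℕ} (h : ∀ s < t, Measurable[I.past s, ⊤] (I.review s)) :
    I.history t ≤ I.past t :=
  iSup_le fun s => ((h s.1 s.2.2).mono (I.past_mono s.2.2.le) le_rfl).comap_le

theorem indep_past_draw (n : ℕ) :
    Indep (I.past n) (MeasurableSpace.comap (I.draw (n + 1)) inferInstance) μ := by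
  have h : Indep (I.past n)
      (⨆ i ∈ ({n + 1} : Set ℕ), MeasurableSpace.comap (I.draw i) inferInstance) μ :=
    indep_iSup_of_disjoint (fun i => (I.measurable_draw i).comap_le) I.indep
      (Set.disjoint_singleton_right.2 (by simp))
  rwa [iSup_singleton] at h

end Past

section Record

local instance : MeasurableSpace (Option F) := ⊤

local instance : DiscreteMeasurableSpace (Option F) := ⟨fun _ => trivial⟩

/-- The reviews of times `1, …, n`, that is, the history of consumer `n + 1`. -/
def record (n : ℕ) (ω : Ω) (i : Fin n) : Option F := I.review (i + 1) ω

theorem history_succ_eq_comap_record (n : ℕ) :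
    I.history (n + 1) = MeasurableSpace.comap (I.record n) inferInstance := by
  simp only [MeasurableSpace.pi, MeasurableSpace.comap_iSup, MeasurableSpace.comap_comp]
  apply le_antisymm
  · refine iSup_le fun ⟨s, hs, hsn⟩ => le_iSup_of_le ⟨s - 1, by omega⟩ (le_of_eq ?_)
    congr 1
    funext ω
    simp [record, Nat.sub_add_cancel hs]
  · exact iSup_le fun i => le_iSup (fun s : {s : ℕ // 1 ≤ s ∧ s < n + 1} =>
      MeasurableSpace.comap (I.review s.1) ⊤) ⟨i + 1, by omega, by omega⟩

theorem record_succ (n : ℕ) : I.record (n + 1) =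
    ((Equiv.prodComm _ _).trans (Fin.snocEquiv fun _ : Fin (n + 1) => Option F)) ∘
      fun ω => (I.record n ω, I.review (n + 1) ω) := by
  funext ω i
  refine Fin.lastCases ?_ (fun i => ?_) i <;> simp [record, Fin.snocEquiv]

section Finite

variable [Finite F]

theorem measurable_past_review (t : ℕ) : Measurable[I.past t] (I.review t) := by
  induction t using Nat.strong_induction_on with
  | _ t ih =>
    have hinfo : I.history t ⊔ MeasurableSpace.comap (I.θ t) inferInstance ≤ I.past t :=
      sup_le (I.history_le_past ih) (measurable_fst.comp (I.measurable_past_shock t)).comap_le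
    have hbuy := hinfo _ ((stronglyMeasurable_condExp (μ := μ)
      (f := fun ω' => M.reward (I.Q t ω') (I.θ t ω'))).measurable (measurableSet_Ioi (a := 0)))
    refine @measurable_to_countable' _ _ _ _ (I.past t) _ fun o => ?_
    cases o with
    | none =>
      convert! hbuy.compl using 1
      ext ω
      simp only [Set.mem_preimage, Set.mem_singleton_iff, Set.mem_compl_iff, Set.mem_Ioi]
      rw [review_eq]
      split_ifs with h <;> simp [h]
    | some z =>
      have hfeedback : MeasurableSet[I.past t]
          (⋃ q, I.Q t ⁻¹' {q} ∩ I.shock t ⁻¹' {x | M.feedback q x.1 x.2 = z}) :=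
        .iUnion fun q => (I.measurable_past_Q t (measurableSet_singleton q)).inter
          (I.measurable_past_shock t (M.feedback_measurable q z))
      convert! hbuy.inter hfeedback using 1
      ext ω
      simp only [Set.mem_preimage, Set.mem_singleton_iff, Set.mem_inter_iff, Set.mem_Ioi,
        Set.mem_iUnion]
      rw [review_eq]
      split_ifs with h <;> simp [h, shock]

theorem measurable_past_record (n : ℕ) : Measurable[I.past n] (I.record n) :=
  @measurable_pi_lambda _ _ _ (I.past n) _ _ fun i =>
    (I.measurable_past_review (i + 1)).mono (I.past_mono (by omega)) le_rfl

theorem measurable_review (t : ℕ) : Measurable (I.review t) :=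
  (I.measurable_past_review t).mono (I.past_le t) le_rfl

theorem measurable_record (n : ℕ) : Measurable (I.record n) :=
  (I.measurable_past_record n).mono (I.past_le n) le_rfl

theorem indepFun_record_Q_draw (n : ℕ) :
    IndepFun (fun ω => (I.record n ω, I.Q n ω)) (I.draw (n + 1)) μ :=
  (IndepFun_iff_Indep _ _ _).2 <| indep_of_indep_of_le_left (I.indep_past_draw n)
    ((I.measurable_past_record n).prodMk (I.measurable_past_Q n)).comap_le

theorem indepFun_record_Q_redraw (n : ℕ) :
    IndepFun (fun ω => (I.record n ω, I.Q n ω))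
      (fun ω => (I.X (n + 1) ω, I.S (n + 1) ω)) μ :=
  (I.indepFun_record_Q_draw n).comp measurable_id
    (measurable_fst.prodMk (measurable_fst.comp measurable_snd))

variable [IsProbabilityMeasure μ] (hη : η ∈ Set.Icc (0 : ℝ) 1)
include hη

theorem indepFun_record_Q_succ_shock (n : ℕ) :
    IndepFun (fun ω => (I.record n ω, I.Q (n + 1) ω)) (I.shock (n + 1)) μ := by
  have hdraw : IndepFun (fun ω => (I.record n ω, I.Q n ω))
      (fun ω => ((I.X (n + 1) ω, I.S (n + 1) ω), I.shock (n + 1) ω)) μ :=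
    (I.indepFun_record_Q_draw n).comp measurable_id
      (MeasurableEquiv.prodAssoc (α := Quality) (β := Bool) (γ := Θ × E)).symm.measurable
  have hpair := indepFun_prodMk_of_indepFun_prodMk ((I.measurable_record n).prodMk
    (I.measurable_Q n)) ((I.X_measurable _).prodMk (I.S_measurable _)) (I.measurable_shock _) hdraw
    (I.indepFun_X_S_prodMk_shock hη (n + 1))
  have hupdate : Measurable fun x : ((Fin n → Option F) × Quality) × Quality × Bool =>
      (x.1.1, if x.2.2 then x.2.1 else x.1.2) :=
    (measurable_fst.comp measurable_fst).prodMk <| Measurable.ite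
      ((measurable_snd.comp measurable_snd) (measurableSet_singleton true))
      (measurable_fst.comp measurable_snd) (measurable_snd.comp measurable_fst)
  exact hpair.comp hupdate measurable_id

theorem indepFun_record_Q_succ_θ (n : ℕ) :
    IndepFun (fun ω => (I.record n ω, I.Q (n + 1) ω)) (I.θ (n + 1)) μ :=
  (I.indepFun_record_Q_succ_shock hη n).comp measurable_id measurable_fst

theorem condExp_reward_ae_eq (n : ℕ) :
    μ[fun ω => M.reward (I.Q (n + 1) ω) (I.θ (n + 1) ω) |
        I.history (n + 1) ⊔ MeasurableSpace.comap (I.θ (n + 1)) inferInstance] =ᵐ[μ]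
      fun ω => M.expectedReward (posterior μ (I.record n) (I.Q (n + 1)) (I.record n ω))
        (I.θ (n + 1) ω) := by
  rw [history_succ_eq_comap_record, ← MeasurableSpace.comap_prodMk]
  exact (condExp_prodMk_ae_eq_of_indepFun (I.measurable_record n) (I.measurable_Q (n + 1))
    (I.θ_measurable (n + 1)) (I.indepFun_record_Q_succ_θ hη n)
    (measurable_from_prod_countable_right M.reward_measurable)
    (I.integrable_reward_Q_θ hη (n + 1))).trans
      (.of_forall fun _ => integral_condDistrib_bool _ _)

theorem review_succ_ae_eq (n : ℕ) :
    I.review (n + 1) =ᵐ[μ] fun ω =>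
      M.response (posterior μ (I.record n) (I.Q (n + 1)) (I.record n ω)) (I.Q (n + 1) ω)
        (I.shock (n + 1) ω) := by
  filter_upwards [I.condExp_reward_ae_eq hη n] with ω hω
  rw [review_eq, hω]
  rfl

theorem posterior_Q_succ {n : ℕ} {h : Fin n → Option F}
    (hh : μ.real (I.record n ⁻¹' {h}) ≠ 0) :
    posterior μ (I.record n) (I.Q (n + 1)) h =
      redrawBelief η (posterior μ (I.record n) (I.Q n) h) := by
  rw [redrawBelief, ← I.measureReal_S_false hη (n + 1),
    ← I.measureReal_X_true_inter_S_true hη (n + 1)]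
  exact posterior_redraw (I.measurable_record n) (I.measurable_Q n) (I.X_measurable _)
    (I.S_measurable _) (I.indepFun_record_Q_redraw n) hh

end Finite

section Entropy

variable [Fintype F] [IsProbabilityMeasure μ]

theorem sum_measureReal_record_mul (n : ℕ) (x : ℝ) :
    ∑ h, μ.real (I.record n ⁻¹' {h}) * x = x := by
  rw [← Finset.sum_mul, sum_probReal_preimage_singleton (I.measurable_record n), one_mul]

theorem condEntropy_Q_succ_le (hη0 : 0 ≤ η) (hη : η ≤ 1 / 2) (n : ℕ) :
    condEntropy μ (I.record n) (I.Q (n + 1)) ≤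
      condEntropy μ (I.record n) (I.Q n) + 4 * Real.negMulLog η := by
  rw [← I.sum_measureReal_record_mul n (4 * Real.negMulLog η), condEntropy, condEntropy,
    ← Finset.sum_add_distrib]
  refine Finset.sum_le_sum fun h _ => ?_
  rcases eq_or_ne (μ.real (I.record n ⁻¹' {h})) 0 with hh | hh
  · simp [hh]
  · rw [I.posterior_Q_succ ⟨hη0, by linarith⟩ hh, ← mul_add]
    exact mul_le_mul_of_nonneg_left (binEntropy_redrawBelief_le hη0 hη (posterior_mem_Icc h))
      measureReal_nonneg

theorem le_condEntropy_Q_succ_add_condError (hη0 : 0 < η) (hη : η < 1 / 2) (n : ℕ) :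
    condEntropy μ (I.record n) (I.Q n) + 1 / 20 * Real.negMulLog η ≤
      condEntropy μ (I.record n) (I.Q (n + 1)) + condError μ (I.record n) (I.Q (n + 1)) := by
  rw [← I.sum_measureReal_record_mul n (1 / 20 * Real.negMulLog η), condEntropy, condEntropy,
    condError, ← Finset.sum_add_distrib, ← Finset.sum_add_distrib]
  refine Finset.sum_le_sum fun h _ => ?_
  have hη1 : η ∈ Set.Icc (0 : ℝ) 1 := ⟨hη0.le, by linarith⟩
  rcases eq_or_ne (μ.real (I.record n ⁻¹' {h})) 0 with hh | hh
  · simp [hh]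
  · have hp := posterior_mem_Icc (μ := μ) (W := I.record n) (q := I.Q n) h
    have hr := redrawBelief_mem_Icc hη1 hp
    rw [I.posterior_Q_succ hη1 hh, ← mul_add, ← mul_add]
    refine mul_le_mul_of_nonneg_left ?_ measureReal_nonneg
    linarith [le_binEntropy_redrawBelief hη0 hη hp, mul_nonneg hr.1 (sub_nonneg.2 hr.2)]

theorem condEntropy_record_succ (hη : η ∈ Set.Icc (0 : ℝ) 1) (n : ℕ) :
    condEntropy μ (I.record (n + 1)) (I.Q (n + 1)) =
      ∑ h, μ.real (I.record n ⁻¹' {h}) *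
        posteriorEntropy (posterior μ (I.record n) (I.Q (n + 1)) h)
          (M.reviewProb (posterior μ (I.record n) (I.Q (n + 1)) h) H)
          (M.reviewProb (posterior μ (I.record n) (I.Q (n + 1)) h) L) := by
  rw [record_succ, condEntropy_equiv_comp _ .of_discrete
    ((I.measurable_record n).prodMk (I.measurable_review (n + 1))) (I.measurable_Q (n + 1)),
    condEntropy_prodMk (I.measurable_record n) (I.measurable_Q (n + 1))
      (I.measurable_shock (n + 1)) (I.measurable_review (n + 1))
      (I.indepFun_record_Q_succ_shock hη n)
      (fun h q z => M.measurableSet_response_eq (posterior μ (I.record n) (I.Q (n + 1)) h) q z)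
      (I.review_succ_ae_eq hη n), I.map_shock hη]
  rfl

theorem condEntropy_record_succ_le (hη : η ∈ Set.Icc (0 : ℝ) 1) (n : ℕ) :
    condEntropy μ (I.record (n + 1)) (I.Q (n + 1)) ≤
      condEntropy μ (I.record n) (I.Q (n + 1)) -
        M.delta ^ 2 / Fintype.card F / 4 * condError μ (I.record n) (I.Q (n + 1)) := by
  rw [I.condEntropy_record_succ hη, condEntropy, condError, Finset.mul_sum,
    ← Finset.sum_sub_distrib]
  refine Finset.sum_le_sum fun h _ => ?_
  rw [mul_left_comm, ← mul_sub]
  exact mul_le_mul_of_nonneg_left (M.posteriorEntropy_reviewProb_le (posterior_mem_Icc h))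
    measureReal_nonneg

theorem le_condEntropy_record_succ (hη : η ∈ Set.Icc (0 : ℝ) 1) {γ : ℝ} (hγ : 0 < γ)
    (hG : ∀ p ∈ Set.Icc (0 : ℝ) 1, ∀ z q, γ ≤ M.G z p q) (n : ℕ) :
    condEntropy μ (I.record n) (I.Q (n + 1)) -
        Fintype.card F / γ / 4 * condError μ (I.record n) (I.Q (n + 1)) ≤
      condEntropy μ (I.record (n + 1)) (I.Q (n + 1)) := by
  rw [I.condEntropy_record_succ hη, condEntropy, condError, Finset.mul_sum,
    ← Finset.sum_sub_distrib]
  refine Finset.sum_le_sum fun h _ => ?_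
  rw [mul_left_comm, ← mul_sub]
  exact mul_le_mul_of_nonneg_left (M.le_posteriorEntropy_reviewProb (posterior_mem_Icc h) hγ
    (hG _ (posterior_mem_Icc h))) measureReal_nonneg

theorem condEntropy_record_zero (hη : η ∈ Set.Icc (0 : ℝ) 1) :
    condEntropy μ (I.record 0) (I.Q 0) = Real.log 2 := by
  have hall (h : Fin 0 → Option F) : I.record 0 ⁻¹' {h} = Set.univ := by
    ext ω
    simp [eq_iff_true_of_subsingleton]
  have hposterior (h : Fin 0 → Option F) : posterior μ (I.record 0) (I.Q 0) h = 2⁻¹ := by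
    have hmass := measureReal_preimage_inter_true (μ := μ) (I.measurable_record 0)
      (I.measurable_Q 0) h
    rw [hall, Set.univ_inter, probReal_univ, one_mul] at hmass
    rw [← hmass]
    exact (I.measureReal_X_true hη 0).trans (one_div 2)
  simp [condEntropy, hall, hposterior]

theorem loss_eq_sum_condError (T : ℕ) :
    I.loss T = ∑ n ∈ Finset.range T, condError μ (I.record n) (I.Q (n + 1)) := by
  rw [loss, ← Finset.Ico_add_one_right_eq_Icc, Finset.sum_Ico_eq_sum_range, add_tsub_cancel_right]
  refine Finset.sum_congr rfl fun n _ => ?_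
  rw [add_comm 1 n, history_succ_eq_comap_record]
  exact integral_norm_condExp_sub_value (I.measurable_record n) (I.measurable_Q (n + 1))

theorem mul_loss_le (hη0 : 0 ≤ η) (hη : η ≤ 1 / 2) (T : ℕ) :
    M.delta ^ 2 / Fintype.card F / 4 * I.loss T ≤ Real.log 2 + T * (4 * Real.negMulLog η) := by
  have hη1 : η ∈ Set.Icc (0 : ℝ) 1 := ⟨hη0, by linarith⟩
  suffices h : ∀ n, M.delta ^ 2 / Fintype.card F / 4 * I.loss n ≤
      Real.log 2 - condEntropy μ (I.record n) (I.Q n) + n * (4 * Real.negMulLog η) by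
    have := condEntropy_nonneg (μ := μ) (W := I.record T) (q := I.Q T)
    linarith [h T]
  intro n
  induction n with
  | zero => simp [loss, I.condEntropy_record_zero hη1]
  | succ n ih =>
    rw [loss_eq_sum_condError] at ih ⊢
    rw [Finset.sum_range_succ]
    push_cast
    linarith [I.condEntropy_record_succ_le hη1 n, I.condEntropy_Q_succ_le hη0 hη n]

theorem mul_negMulLog_le_mul_loss (hη0 : 0 < η) (hη : η < 1 / 2) {γ : ℝ} (hγ : 0 < γ)
    (hG : ∀ p ∈ Set.Icc (0 : ℝ) 1, ∀ z q, γ ≤ M.G z p q) (T : ℕ) :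
    T * (1 / 20 * Real.negMulLog η) ≤ (1 + Fintype.card F / γ / 4) * I.loss T := by
  have hη1 : η ∈ Set.Icc (0 : ℝ) 1 := ⟨hη0.le, by linarith⟩
  suffices h : ∀ n : ℕ, Real.log 2 + n * (1 / 20 * Real.negMulLog η) ≤
      condEntropy μ (I.record n) (I.Q n) + (1 + Fintype.card F / γ / 4) * I.loss n by
    linarith [h T, condEntropy_le_log_two (μ := μ) (q := I.Q T) (I.measurable_record T)]
  intro n
  induction n with
  | zero => simp [loss, I.condEntropy_record_zero hη1]
  | succ n ih =>
    rw [loss_eq_sum_condError] at ih ⊢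
    rw [Finset.sum_range_succ]
    push_cast
    linarith [I.le_condEntropy_record_succ hη1 hγ hG n,
      I.le_condEntropy_Q_succ_add_condError hη0 hη n]

end Entropy

end Record

end Inputs

end SocialLearning

end

theorem mainTheorem1_general {Θ E F : Type*} [MeasurableSpace Θ] [MeasurableSpace E] [Fintype F]
    (M : SocialLearning.Market Θ E F)
    (hpos : ∀ p ∈ Set.Icc (0 : ℝ) 1, ∀ z q, 0 < M.G z p q) (hdelta : 0 < M.delta)
    (c₀ : ℝ) (hc₀ : 0 < c₀) :
    ∃ c C : ℝ, 0 < c ∧ 0 < C ∧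
      ∀ (η : ℝ) (T : ℕ), 0 < η → η < 1 / 2 → c₀ ≤ η * T →
        ∀ (Ω : Type*) [MeasurableSpace Ω] (μ : Measure Ω) [IsProbabilityMeasure μ]
          (I : SocialLearning.Inputs M η μ),
          c * (Real.log (1 / η) * η * T) ≤ I.loss T ∧
            I.loss T ≤ C * (Real.log (1 / η) * η * T) := by
  obtain ⟨γ, hγ, hG⟩ := M.exists_pos_le_G hpos
  have : Nonempty F := M.nonempty_of_delta_pos hdelta
  refine ⟨1 / 20 / (1 + Fintype.card F / γ / 4),
    (4 + 1 / c₀) / (M.delta ^ 2 / Fintype.card F / 4), by positivity, by positivity, ?_⟩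
  intro η T hη0 hη hT Ω _ μ _ I
  have hlog : Real.log (1 / η) * η = Real.negMulLog η := by
    rw [one_div, Real.log_inv, Real.negMulLog, neg_mul_comm, mul_comm, neg_mul_comm]
  have hlower := I.mul_negMulLog_le_mul_loss hη0 hη hγ hG T
  have hupper := I.mul_loss_le hη0.le hη.le T
  have hlog_two : Real.log 2 ≤ 1 / c₀ * (Real.negMulLog η * T) := by
    rw [div_mul_eq_mul_div, le_div_iff₀ hc₀, one_mul]
    calc Real.log 2 * c₀ ≤ Real.log 2 * (η * T) := by gcongr
      _ = Real.log 2 * η * T := by ring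
      _ ≤ Real.negMulLog η * T := by
          gcongr
          exact SocialLearning.log_two_mul_le_negMulLog hη0.le hη.le
  rw [hlog]
  constructor
  · rw [div_mul_eq_mul_div, div_le_iff₀ (by positivity)]
    linarith
  · rw [div_mul_eq_mul_div, le_div_iff₀ (by positivity)]
    linarith

theorem mainTheorem1 {Θ E F : Type*} [MeasurableSpace Θ] [MeasurableSpace E] [Fintype F]
    (M : SocialLearning.Market Θ E F) (hbuy : M.PurchaseGuarantee) (hident : M.Identifiable)
    (hdelta : 0 < M.delta) (c₀ : ℝ) (hc₀ : 0 < c₀) :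
    ∃ c C : ℝ, 0 < c ∧ 0 < C ∧
      ∀ (η : ℝ) (T : ℕ), 0 < η → η < 1 / 2 → 1 ≤ T → c₀ ≤ η * T →
        ∀ (Ω : Type*) [MeasurableSpace Ω] (μ : Measure Ω) [IsProbabilityMeasure μ]
          (I : SocialLearning.Inputs M η μ),
          c * (Real.log (1 / η) * η * T) ≤ I.loss T ∧
            I.loss T ≤ C * (Real.log (1 / η) * η * T) := by
  obtain ⟨c, C, hc, hC, h⟩ :=
    mainTheorem1_general M (fun p hp => (hident p hp).1) hdelta c₀ hc₀
  exact ⟨c, C, hc, hC, fun η T hη0 hη _ => h η T hη0 hη⟩
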